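/- Let $\mathcal X$ be a complex Banach space that is separable or reflexive, let $T\in L(\mathcal X)$ be a bounded linear operator with spectrum $\sigma(T)$ and resolvent set $\rho(T)=\mathbb C\setminus\sigma(T)$, and let $m\ge 1$ be an integer. Put $\alpha(T):=\min\{n\in\mathbb N_0:\ker T^{n+1}=\ker T^n\}$ (ascent) and $\delta(T):=\min\{n\in\mathbb N_0:\operatorname{ran}T^{n+1}=\operatorname{ran}T^n\}$ (descent), with value $\infty$ if the minimum does not exist. An isolated point of $\sigma(T)$ is in particular a point of $\sigma(T)$. The following statements are equivalent. (i) $0$ is a pole of order $m$ of the resolvent $\lambda\mapsto(T-\lambda)^{-1}$. (ii) $0$ is an isolated point of $\sigma(T)$, and $m$ is the least $k\in\mathbb N_0$ with $T^k\int_{C}(T-\lambda)^{-1}\,d\lambda=0$, where $C=\partial B_r(0)$ with $r>0$ such that $\overline{B_r(0)}\cap\sigma(T)=\{0\}$. (It is equivalent to require this for one such $r$ or for every such $r$.) (iii) $0$ is an isolated point of $\sigma(T)$ and $\delta(T)=m$. (iv) $T$ is not invertible, and $m$ is the least integer $k\ge1$ with $\mathcal X=\ker T^k\oplus\operatorname{ran}T^k$.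 (v) $\alpha(T)=\delta(T)=m$. (vi) $\operatorname{ran}T^m$ is closed, and there is a sequence $(\lambda_n)\subset\rho(T)\setminus\{0\}$ with $\lambda_n\to0$ such that $m$ is the least $k\in\mathbb N_0$ with $\|(T-\lambda_n)^{-1}\|=O(|\lambda_n|^{-k})$ as $n\to\infty$. (vii) $\delta(T)<\infty$, and there is a sequence $(\lambda_n)$ as in (vi). -/

import Mathlib

open Filter Topology Asymptotics

noncomputable section

namespace PoleResolvent

variable {X : Type*} [NormedAddCommGroup X] [NormedSpace ℂ X]

/-- A Banach space is reflexive if the canonical map into its bidual is onto. -/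
def Reflexive (X : Type*) [NormedAddCommGroup X] [NormedSpace ℂ X] : Prop :=
  Function.Surjective (NormedSpace.inclusionInDoubleDual ℂ X)

/-- The inverse `(T - z)⁻¹` in the algebra of bounded operators, for `z` in the resolvent set
of `T`. (Outside of the resolvent set, the value is `0` by convention.) -/
def res (T : X →L[ℂ] X) (z : ℂ) : X →L[ℂ] X :=
  Ring.inverse (T - z • (1 : X →L[ℂ] X))

/-- On the resolvent set, `res T z` really is a two-sided inverse of `T - z`. -/
theorem res_mul_cancel (T : X →L[ℂ] X) {z : ℂ} (hz : z ∈ resolventSet ℂ T) :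
    res T z * (T - z • (1 : X →L[ℂ] X)) = 1 ∧ (T - z • (1 : X →L[ℂ] X)) * res T z = 1 := by
  have h : IsUnit (T - z • (1 : X →L[ℂ] X)) := by
    have h1 := (spectrum.mem_resolventSet_iff.mp hz).neg
    rwa [neg_sub, Algebra.algebraMap_eq_smul_one] at h1
  exact ⟨Ring.inverse_mul_cancel _ h, Ring.mul_inverse_cancel _ h⟩

/-- `0` is an isolated point of the spectrum of `T` (in particular, it belongs to it). -/
def ZeroIsolated (T : X →L[ℂ] X) : Prop :=
  0 ∈ spectrum ℂ T ∧ ∀ᶠ z in 𝓝[≠] (0 : ℂ), z ∉ spectrum ℂ T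

/-- `0` is a pole of order `m` of the resolvent `z ↦ (T - z)⁻¹`: the resolvent is defined on a
punctured neighbourhood of `0`, is meromorphic at `0`, and its order of vanishing there is
`-m`. -/
def ZeroIsPole (T : X →L[ℂ] X) (m : ℕ) : Prop :=
  (∀ᶠ z in 𝓝[≠] (0 : ℂ), z ∈ resolventSet ℂ T) ∧
    MeromorphicAt (res T) 0 ∧ meromorphicOrderAt (res T) 0 = ((-(m : ℤ) : ℤ) : WithTop ℤ)

/-- The least `n` with `ker T ^ (n + 1) = ker T ^ n`, and `⊤` if there is none. -/
def ascent (T : X →L[ℂ] X) : ℕ∞ :=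
  ⨅ (n : ℕ) (_ : (T ^ (n + 1)).ker = (T ^ n).ker), (n : ℕ∞)

/-- The least `n` with `ran T ^ (n + 1) = ran T ^ n`, and `⊤` if there is none. -/
def descent (T : X →L[ℂ] X) : ℕ∞ :=
  ⨅ (n : ℕ) (_ : (T ^ (n + 1)).range = (T ^ n).range), (n : ℕ∞)

/-- `X` is the direct sum of `ker T ^ k` and `ran T ^ k`. -/
def Decomposes (T : X →L[ℂ] X) (k : ℕ) : Prop :=
  IsCompl (T ^ k).ker (T ^ k).range

/-- `T ^ k ∘ ∫_C (T - z)⁻¹ dz = 0`, where `C` is the positively oriented circle of radius `r`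
around `0`. -/
def KillsCircle (T : X →L[ℂ] X) (r : ℝ) (k : ℕ) : Prop :=
  T ^ k * (∮ z in C(0, r), res T z) = 0

/-- `(l n)` is a sequence of non-zero numbers in the resolvent set of `T` tending to `0`, and `m`
is the least natural number with `‖(T - l n)⁻¹‖ = O(|l n| ^ (-m))` as `n → ∞`. -/
def GrowthSeq (T : X →L[ℂ] X) (l : ℕ → ℂ) (m : ℕ) : Prop :=
  (∀ n, l n ∈ resolventSet ℂ T ∧ l n ≠ 0) ∧ Tendsto l atTop (𝓝 0) ∧
    IsLeast {k : ℕ | (fun n => ‖res T (l n)‖) =O[atTop] (fun n => ‖l n‖ ^ (-(k : ℤ)))} m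

end PoleResolvent

end

/-! ### Algebra of ascent, descent and the decomposition of the space -/

namespace PoleResolvent

variable {X : Type*} [NormedAddCommGroup X] [NormedSpace ℂ X]

/-! Every condition is reduced to one fact (`exists_pole_of_rangeStable`): if `0` is a spectral
value, resolvent points accumulate at `0`, and the descent is finite, then ascent and descent have a
common value `p` and `0` is a pole of order `p`.

The analytic input is that surjectivity survives small perturbations with a uniform bound on
preimages. Applied to `(y, n) ↦ T y + n` on `X × ker T ^ d`, it turns finite descent into finite
ascent (`RangeStable.kerStable_of_frequently`). Algebra then gives `X = ker T ^ p ⊕ ran T ^ p`. On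
the first summand `T` is nilpotent and on the second invertible, so the Drazin inverse yields an
explicit Laurent expansion whose leading coefficient is `-T ^ (p - 1) * Q ≠ 0`.

Finite descent is extracted from the contour condition by integrating `z⁻¹ • res T z`, and from the
growth condition with closed range by the same perturbation principle. Since each condition
determines its integer uniquely, comparing it with `p` gives `m = p`. -/

theorem iInf_natCast_eq_iff {P : ℕ → Prop} {m : ℕ} :
    (⨅ (n : ℕ) (_ : P n), (n : ℕ∞)) = m ↔ IsLeast {n | P n} m := by
  constructor
  · intro h
    have hlow : ∀ n, P n → m ≤ n := fun n hn => by
      have : (m : ℕ∞) ≤ n := h ▸ iInf₂_le n hn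
      exact_mod_cast this
    refine ⟨?_, hlow⟩
    by_contra hm
    have : ((m + 1 : ℕ) : ℕ∞) ≤ ⨅ (n : ℕ) (_ : P n), (n : ℕ∞) := by
      refine le_iInf₂ fun n hn => ?_
      have h1 := hlow n hn
      have h2 : m ≠ n := fun h => hm (h ▸ hn)
      exact_mod_cast (by omega : m + 1 ≤ n)
    rw [h] at this
    have : m + 1 ≤ m := by exact_mod_cast this
    omega
  · rintro ⟨h1, h2⟩
    refine le_antisymm (iInf₂_le m h1) (le_iInf₂ fun n hn => ?_)
    exact_mod_cast h2 hn

theorem iInf_natCast_lt_top_iff {P : ℕ → Prop} :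
    (⨅ (n : ℕ) (_ : P n), (n : ℕ∞)) < ⊤ ↔ ∃ n, P n := by
  simp [iInf_lt_iff]

/-- The kernels of the powers of `T` are constant from `n` on. -/
def KerStable (T : X →L[ℂ] X) (n : ℕ) : Prop := (T ^ (n + 1)).ker = (T ^ n).ker

/-- The ranges of the powers of `T` are constant from `n` on. -/
def RangeStable (T : X →L[ℂ] X) (n : ℕ) : Prop := (T ^ (n + 1)).range = (T ^ n).range

theorem ascent_eq_iff {T : X →L[ℂ] X} {m : ℕ} :
    ascent T = m ↔ IsLeast {n | KerStable T n} m := iInf_natCast_eq_iff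

theorem descent_eq_iff {T : X →L[ℂ] X} {m : ℕ} :
    descent T = m ↔ IsLeast {n | RangeStable T n} m := iInf_natCast_eq_iff

theorem pow_add_apply (T : X →L[ℂ] X) (a b : ℕ) (x : X) :
    (T ^ (a + b)) x = (T ^ a) ((T ^ b) x) := by
  rw [pow_add]; rfl

theorem kerStable_iff {T : X →L[ℂ] X} {n : ℕ} :
    KerStable T n ↔ ∀ x, (T ^ (n + 1)) x = 0 → (T ^ n) x = 0 := by
  constructor
  · intro h x hx
    have : x ∈ (T ^ n).ker := h ▸ (show x ∈ (T ^ (n + 1)).ker from hx)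
    exact this
  · intro h
    refine le_antisymm (fun x hx => h x hx) fun x hx => ?_
    have hx' : (T ^ n) x = 0 := hx
    change (T ^ (n + 1)) x = 0
    rw [add_comm, pow_add_apply, hx', map_zero]

theorem rangeStable_iff {T : X →L[ℂ] X} {n : ℕ} :
    RangeStable T n ↔ ∀ x, ∃ y, (T ^ (n + 1)) y = (T ^ n) x := by
  constructor
  · intro h x
    have : (T ^ n) x ∈ (T ^ (n + 1)).range := h ▸ ⟨x, rfl⟩
    exact this
  · intro h
    refine le_antisymm ?_ ?_
    · rintro _ ⟨x, rfl⟩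
      exact ⟨T x, (pow_add_apply T n 1 x).symm.trans rfl⟩
    · rintro _ ⟨x, rfl⟩
      exact h x

theorem KerStable.apply_eq_zero {T : X →L[ℂ] X} {n : ℕ} (h : KerStable T n) (k : ℕ) {x : X}
    (hx : (T ^ (k + n)) x = 0) : (T ^ n) x = 0 := by
  induction k generalizing x with
  | zero => simpa using hx
  | succ k ih =>
    have h1 : (T ^ (k + n)) (T x) = 0 := by
      rw [show k + 1 + n = k + n + 1 by ring, pow_add_apply] at hx
      simpa using hx
    refine kerStable_iff.mp h x ?_
    rw [pow_add_apply]
    simpa using ih h1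

theorem RangeStable.exists_apply_eq {T : X →L[ℂ] X} {n : ℕ} (h : RangeStable T n) (k : ℕ)
    (x : X) : ∃ y, (T ^ (k + n)) y = (T ^ n) x := by
  induction k with
  | zero => exact ⟨x, by simp⟩
  | succ k ih =>
    obtain ⟨y, hy⟩ := ih
    obtain ⟨z, hz⟩ := rangeStable_iff.mp h y
    refine ⟨z, ?_⟩
    rw [show k + 1 + n = k + (n + 1) by ring, pow_add_apply, hz, ← pow_add_apply, hy]

/-- If `T ^ d x = T ^ (d + 1) y`, then `x - T y` is killed by a power of `T`, hence already by `T ^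
a`. With the dual `RangeStable.kerStable`, the two kinds of stable exponents form the same set once
both exist, so ascent equals descent. -/
theorem KerStable.rangeStable {T : X →L[ℂ] X} {a d : ℕ} (ha : KerStable T a)
    (hd : RangeStable T d) : RangeStable T a := by
  refine rangeStable_iff.mpr fun x => ?_
  obtain ⟨y, hy⟩ := rangeStable_iff.mp hd x
  refine ⟨y, ?_⟩
  have h1 : (T ^ (d + a)) (x - T y) = 0 := by
    have h2 : (T ^ d) (x - T y) = 0 := by
      rw [map_sub, ← hy, pow_add_apply, pow_one, sub_self]
    rw [add_comm, pow_add_apply, h2, map_zero]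
  have h3 := ha.apply_eq_zero d h1
  rw [map_sub, sub_eq_zero] at h3
  rw [h3, pow_add_apply, pow_one]

theorem RangeStable.kerStable {T : X →L[ℂ] X} {a d : ℕ} (hd : RangeStable T d)
    (ha : KerStable T a) : KerStable T d := by
  refine kerStable_iff.mpr fun x hx => ?_
  obtain ⟨y, hy⟩ := hd.exists_apply_eq a x
  have h1 : (T ^ (d + 1 + a)) y = 0 := by
    rw [add_comm, pow_add_apply, pow_succ'] at hx
    have h2 : T ((T ^ d) x) = 0 := by simpa [← pow_succ', pow_succ, pow_add_apply] using hx
    rw [← hy] at h2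
    rw [show d + 1 + a = 1 + (a + d) by ring, pow_add_apply]
    simpa using h2
  have h3 := ha.apply_eq_zero (d + 1) h1
  rw [← hy, add_comm, pow_add_apply, h3, map_zero]

theorem exists_ascent_eq_descent {T : X →L[ℂ] X} {a d : ℕ} (ha : KerStable T a)
    (hd : RangeStable T d) : ∃ p : ℕ, IsLeast {n | KerStable T n} p ∧
      IsLeast {n | RangeStable T n} p := by
  classical
  have hset : {n | KerStable T n} = {n | RangeStable T n} :=
    Set.ext fun n => ⟨fun h => h.rangeStable hd, fun h => h.kerStable ha⟩
  refine ⟨Nat.find ⟨a, ha⟩, ?_⟩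
  rw [← hset, and_self]
  exact ⟨Nat.find_spec ⟨a, ha⟩, fun n hn => Nat.find_min' _ hn⟩

/-- If `T ^ (k + 1) x = 0`, then `T ^ k x` lies in `ker T ^ k ∩ ran T ^ k`, because `2 * k ≥ k + 1`.
This needs `k ≥ 1`: for `k = 0` the decomposition always holds. -/
theorem kerStable_of_decomposes {T : X →L[ℂ] X} {k : ℕ} (hk : 1 ≤ k) (h : Decomposes T k) :
    KerStable T k := by
  refine kerStable_iff.mpr fun x hx => ?_
  obtain ⟨j, rfl⟩ := Nat.exists_eq_add_of_le' hk
  refine Submodule.disjoint_def.mp h.disjoint _ ?_ ⟨x, rfl⟩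
  change (T ^ (j + 1)) ((T ^ (j + 1)) x) = 0
  rw [← pow_add_apply, show j + 1 + (j + 1) = j + (j + 1 + 1) by ring, pow_add_apply, hx, map_zero]

theorem rangeStable_of_decomposes {T : X →L[ℂ] X} {k : ℕ} (hk : 1 ≤ k) (h : Decomposes T k) :
    RangeStable T k := by
  refine rangeStable_iff.mpr fun x => ?_
  obtain ⟨j, rfl⟩ := Nat.exists_eq_add_of_le' hk
  have hx : x ∈ (T ^ (j + 1)).ker ⊔ (T ^ (j + 1)).range := h.sup_eq_top ▸ Submodule.mem_top
  obtain ⟨u, hu, _, ⟨v, rfl⟩, rfl⟩ := Submodule.mem_sup.mp hx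
  have hu' : (T ^ (j + 1)) u = 0 := hu
  refine ⟨(T ^ j) v, ?_⟩
  rw [map_add, hu', zero_add, ← pow_add_apply]
  change _ = (T ^ (j + 1)) ((T ^ (j + 1)) v)
  rw [← pow_add_apply]
  congr 2
  ring

theorem decomposes_of_stable {T : X →L[ℂ] X} {p : ℕ} (ha : KerStable T p)
    (hd : RangeStable T p) : Decomposes T p := by
  refine IsCompl.of_eq ?_ ?_
  · refine (Submodule.eq_bot_iff _).mpr ?_
    rintro _ ⟨h1, ⟨x, rfl⟩⟩
    refine ha.apply_eq_zero p ?_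
    rw [pow_add_apply]
    exact h1
  · refine eq_top_iff.mpr fun x _ => ?_
    obtain ⟨y, hy⟩ := hd.exists_apply_eq p x
    refine Submodule.mem_sup.mpr ⟨x - (T ^ p) y, ?_, (T ^ p) y, ⟨y, rfl⟩, by abel⟩
    change (T ^ p) (x - (T ^ p) y) = 0
    rw [map_sub, ← pow_add_apply, hy, sub_self]

end PoleResolvent

/-! ### Perturbation of surjections and its consequences for ascent and descent -/

namespace PoleResolvent

/-- Surjectivity of an operator between Banach spaces, with a bound on preimages, is stable under
small perturbations. -/
theorem exists_preimage_norm_le_of_norm_sub_le {E F : Type*} [NormedAddCommGroup E]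
    [NormedSpace ℂ E] [CompleteSpace E] [NormedAddCommGroup F] [NormedSpace ℂ F] [CompleteSpace F]
    (f : E →L[ℂ] F) (hf : Function.Surjective f) :
    ∃ C : ℝ, ∃ ε > 0, ∀ g : E →L[ℂ] F, ‖g - f‖ ≤ ε → ∀ y, ∃ x, g x = y ∧ ‖x‖ ≤ C * ‖y‖ := by
  have hr : f.range = ⊤ := LinearMap.range_eq_top.mpr hf
  set f' := f.nonlinearRightInverseOfSurjective hr
  have hpos : 0 < f'.nnnorm := f.nonlinearRightInverseOfSurjective_nnnorm_pos hr
  have hpos' : (0 : ℝ) < f'.nnnorm := hpos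
  -- With `N = f'.nnnorm`, the perturbation uses up half of the margin `N⁻¹`, and the ball of radius
  -- `2 * N * ‖y‖` then covers radius `(N⁻¹ - N⁻¹ / 2) * (2 * N * ‖y‖) = ‖y‖`.
  refine ⟨2 * f'.nnnorm, ((f'.nnnorm⁻¹ / 2 : NNReal) : ℝ), by positivity, fun g hg y => ?_⟩
  have happ : ApproximatesLinearOn g f Set.univ (f'.nnnorm⁻¹ / 2) := fun x _ y _ => by
    rw [← map_sub, ← sub_apply]
    exact (g - f).le_of_opNorm_le hg _
  have h := happ.surjOn_closedBall_of_nonlinearRightInverse f'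
    (b := 0) (ε := 2 * f'.nnnorm * ‖y‖) (by positivity) (Set.subset_univ _)
  have hy : y ∈ Metric.closedBall (g 0)
      (((f'.nnnorm : ℝ)⁻¹ - (f'.nnnorm⁻¹ / 2 : NNReal)) * (2 * f'.nnnorm * ‖y‖)) := by
    rw [map_zero, mem_closedBall_zero_iff]
    push_cast
    apply le_of_eq
    field_simp
    ring
  obtain ⟨x, hx, rfl⟩ := h hy
  exact ⟨x, rfl, mem_closedBall_zero_iff.mp hx⟩

variable {X : Type*} [NormedAddCommGroup X] [NormedSpace ℂ X]

theorem zero_mem_resolventSet_iff {T : X →L[ℂ] X} : 0 ∈ resolventSet ℂ T ↔ IsUnit T := by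
  rw [spectrum.mem_resolventSet_iff, map_zero, zero_sub, IsUnit.neg_iff]

theorem isUnit_sub_smul {T : X →L[ℂ] X} {z : ℂ} (hz : z ∈ resolventSet ℂ T) :
    IsUnit (T - z • (1 : X →L[ℂ] X)) :=
  ⟨⟨_, _, (res_mul_cancel T hz).2, (res_mul_cancel T hz).1⟩, rfl⟩

theorem mul_res {T : X →L[ℂ] X} {z : ℂ} (hz : z ∈ resolventSet ℂ T) :
    T * res T z = 1 + z • res T z := by
  have h := (res_mul_cancel T hz).2
  rw [sub_mul, smul_mul_assoc, one_mul, sub_eq_iff_eq_add] at h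
  exact h

theorem pow_mul_res {T : X →L[ℂ] X} {z : ℂ} (hz : z ∈ resolventSet ℂ T) (m : ℕ) :
    T ^ m * res T z = ∑ i ∈ Finset.range m, z ^ (m - 1 - i) • T ^ i + z ^ m • res T z := by
  have hc : Commute T (z • (1 : X →L[ℂ] X)) := (Commute.one_right T).smul_right z
  have h := hc.geom_sum₂_mul m
  simp only [smul_pow, one_pow, mul_smul_comm, mul_one] at h
  have h2 := congrArg (· * res T z) h
  simp only [mul_assoc, (res_mul_cancel T hz).2, mul_one, sub_mul, smul_mul_assoc, one_mul] at h2
  rw [h2, sub_add_cancel]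

/-- For `T ^ (m + 1) x = 0`, solve `(T - z) y + n = z x` with `n ∈ ker T ^ m` and `‖y‖ ≤ C |z| ‖x‖`.
Applying `T ^ m` gives `(T - z) T ^ m (x + y) = 0`, so `T ^ m x = -T ^ m y` for resolvent points
`z`, and letting `z → 0` gives `T ^ m x = 0`. -/
theorem RangeStable.kerStable_of_frequently [CompleteSpace X] {T : X →L[ℂ] X} {m : ℕ}
    (h : RangeStable T m) (hT : ∃ᶠ z in 𝓝 (0 : ℂ), z ∈ resolventSet ℂ T) : KerStable T m := by
  set N := (T ^ m).ker
  have hN : IsClosed (N : Set X) := (T ^ m).isClosed_ker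
  have : CompleteSpace N := hN.completeSpace_coe
  let A : (X × N) →L[ℂ] X :=
    T.comp (ContinuousLinearMap.fst ℂ X N) + N.subtypeL.comp (ContinuousLinearMap.snd ℂ X N)
  have hA : Function.Surjective A := fun x => by
    obtain ⟨y, hy⟩ := rangeStable_iff.mp h x
    refine ⟨(y, ⟨x - T y, ?_⟩), ?_⟩
    · change (T ^ m) (x - T y) = 0
      rw [map_sub, ← hy, pow_add_apply, pow_one, sub_self]
    · change T y + (x - T y) = x
      abel
  obtain ⟨C, ε, hε, hC⟩ := exists_preimage_norm_le_of_norm_sub_le A hA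
  refine kerStable_iff.mpr fun x hx => ?_
  have hbound : ∃ᶠ z in 𝓝 (0 : ℂ), ‖(T ^ m) x‖ ≤ ‖T ^ m‖ * (C * (‖z‖ * ‖x‖)) := by
    refine (hT.and_eventually (Metric.closedBall_mem_nhds (0 : ℂ) hε)).mono ?_
    rintro z ⟨hz, hzε⟩
    have hzε : ‖z‖ ≤ ε := mem_closedBall_zero_iff.mp hzε
    obtain ⟨⟨y, n⟩, hy, hyC⟩ := hC (A - z • ContinuousLinearMap.fst ℂ X N) (by
      rw [sub_sub_cancel_left, norm_neg]
      refine ContinuousLinearMap.opNorm_le_bound _ hε.le fun v => ?_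
      rw [smul_apply, norm_smul]
      exact mul_le_mul hzε (norm_fst_le v) (norm_nonneg _) hε.le) (z • x)
    have hy' : T y + (n : X) - z • y = z • x := hy
    have hn : (T ^ m) (n : X) = 0 := n.2
    have hcomm : ∀ v, (T ^ m) (T v) = T ((T ^ m) v) := fun v => by
      change (T ^ m * T) v = (T * T ^ m) v
      rw [← pow_succ, pow_succ']
    have hTx : T ((T ^ m) x) = 0 := by
      rw [← hcomm]
      rwa [pow_add_apply, pow_one] at hx
    have h1 := congrArg (T ^ m) hy'
    rw [map_sub, map_add, hn, add_zero, map_smul, map_smul, hcomm] at h1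
    have h2 : (T - z • (1 : X →L[ℂ] X)) ((T ^ m) (x + y)) = 0 := by
      change T ((T ^ m) (x + y)) - z • (T ^ m) (x + y) = 0
      rw [map_add, map_add, hTx, smul_add, ← h1]
      abel
    have h3 : (T ^ m) (x + y) = 0 := by
      have := congrArg (· ((T ^ m) (x + y))) (res_mul_cancel T hz).1
      change res T z ((T - z • (1 : X →L[ℂ] X)) ((T ^ m) (x + y))) = (T ^ m) (x + y) at this
      rw [← this, h2, map_zero]
    rw [map_add] at h3
    rw [eq_neg_of_add_eq_zero_left h3, norm_neg]
    refine (T ^ m).le_opNorm_of_le ?_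
    rw [← norm_smul]
    exact (norm_fst_le (y, n)).trans hyC
  have hlim : Tendsto (fun z : ℂ => ‖T ^ m‖ * (C * (‖z‖ * ‖x‖))) (𝓝 0) (𝓝 0) := by
    have : Continuous (fun z : ℂ => ‖T ^ m‖ * (C * (‖z‖ * ‖x‖))) := by fun_prop
    simpa using this.tendsto 0
  exact norm_le_zero_iff.mp (ge_of_tendsto_of_frequently hlim hbound)

/-- The operators `T ^ (m + 1) * res T (l n)` converge in norm to `T ^ m`, which is onto its closed,
hence complete, range. So one of them is also onto that range, which therefore lies in `ran T ^ (m +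
1)`. -/
theorem rangeStable_of_isBigO [CompleteSpace X] {T : X →L[ℂ] X} {l : ℕ → ℂ} {m : ℕ}
    (hl : ∀ n, l n ∈ resolventSet ℂ T ∧ l n ≠ 0) (hl0 : Tendsto l atTop (𝓝 0))
    (hO : (fun n => ‖res T (l n)‖) =O[atTop] (fun n => ‖l n‖ ^ (-(m : ℤ))))
    (hcl : IsClosed ((T ^ m).range : Set X)) : RangeStable T m := by
  have hlim : Tendsto (fun n => T ^ m * (T * res T (l n))) atTop (𝓝 (T ^ m)) := by
    have h1 : ∀ n, T ^ m * (T * res T (l n)) =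
        T ^ m + (l n • ∑ i ∈ Finset.range m, l n ^ (m - 1 - i) • T ^ i +
          l n • (l n ^ m • res T (l n))) := fun n => by
      rw [mul_res (hl n).1, mul_add, mul_one, mul_smul_comm, pow_mul_res (hl n).1, smul_add]
    simp_rw [h1]
    have h2 : Tendsto (fun n => l n • ∑ i ∈ Finset.range m, l n ^ (m - 1 - i) • T ^ i) atTop
        (𝓝 0) := by
      have : Continuous fun z : ℂ => z • ∑ i ∈ Finset.range m, z ^ (m - 1 - i) • T ^ i := by
        fun_prop
      simpa [Function.comp_def] using (this.tendsto 0).comp hl0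
    have h3 : Tendsto (fun n => l n • (l n ^ m • res T (l n))) atTop (𝓝 0) := by
      refine hl0.zero_smul_isBoundedUnder_le ?_
      obtain ⟨C, hC⟩ := hO.bound
      refine ⟨C, hC.mono fun n hn => ?_⟩
      have hpos : 0 < ‖l n‖ ^ m := pow_pos (norm_pos_iff.mpr (hl n).2) m
      rw [norm_norm, zpow_neg, zpow_natCast, norm_inv, norm_pow, norm_norm] at hn
      change ‖l n ^ m • res T (l n)‖ ≤ C
      rw [norm_smul, norm_pow, mul_comm]
      rwa [← div_eq_mul_inv, le_div_iff₀ hpos] at hn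
    simpa using (tendsto_const_nhds (x := T ^ m)).add (h2.add h3)
  set M := (T ^ m).range
  have : CompleteSpace M := hcl.completeSpace_coe
  let f : X →L[ℂ] M := (T ^ m).codRestrict M fun x => ⟨x, rfl⟩
  have hf : Function.Surjective f := by
    rintro ⟨_, x, rfl⟩
    exact ⟨x, rfl⟩
  obtain ⟨C, ε, hε, hC⟩ := exists_preimage_norm_le_of_norm_sub_le f hf
  obtain ⟨n, hn⟩ := (hlim.eventually (Metric.closedBall_mem_nhds (T ^ m) hε)).exists
  rw [dist_eq_norm] at hn
  let g : X →L[ℂ] M := (T ^ m * (T * res T (l n))).codRestrict M fun x => ⟨_, rfl⟩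
  have hg : ‖g - f‖ ≤ ε := ContinuousLinearMap.opNorm_le_bound _ hε.le fun x =>
    (T ^ m * (T * res T (l n)) - T ^ m).le_of_opNorm_le hn x
  refine rangeStable_iff.mpr fun x => ?_
  obtain ⟨y, hy, -⟩ := hC g hg (f x)
  refine ⟨res T (l n) y, ?_⟩
  rw [pow_add_apply, pow_one]
  exact congrArg Subtype.val hy

end PoleResolvent

/-! ### Growth of the resolvent and its contour integral -/

namespace PoleResolvent

variable {X : Type*} [NormedAddCommGroup X] [NormedSpace ℂ X]

theorem mem_resolventSet_of_inter_eq {T : X →L[ℂ] X} {r : ℝ}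
    (h : Metric.closedBall (0 : ℂ) r ∩ spectrum ℂ T = {0}) {z : ℂ}
    (hz : z ∈ Metric.closedBall (0 : ℂ) r) (hz0 : z ≠ 0) : z ∈ resolventSet ℂ T := by
  by_contra hzs
  exact hz0 (Set.mem_singleton_iff.mp (h ▸ ⟨hz, hzs⟩))

theorem ZeroIsPole.exists_tendsto {T : X →L[ℂ] X} {m : ℕ} (h : ZeroIsPole T m) :
    ∃ L : X →L[ℂ] X, L ≠ 0 ∧ Tendsto (fun z => z ^ m • res T z) (𝓝[≠] 0) (𝓝 L) := by
  obtain ⟨-, hmero, hord⟩ := h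
  obtain ⟨g, hg, hg0, hev⟩ := (meromorphicOrderAt_eq_int_iff hmero).mp hord
  refine ⟨g 0, hg0, (hg.continuousAt.tendsto.mono_left nhdsWithin_le_nhds).congr' ?_⟩
  filter_upwards [hev, self_mem_nhdsWithin] with z hz hz0
  rw [hz, sub_zero, zpow_neg, zpow_natCast, smul_inv_smul₀ (pow_ne_zero m hz0)]

/-- A bound with exponent `k < m` would force `l n ^ m • res T (l n) → 0`, but the limit is the
nonzero leading Laurent coefficient. -/
theorem ZeroIsPole.growthSeq {T : X →L[ℂ] X} {m : ℕ} (h : ZeroIsPole T m) {l : ℕ → ℂ}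
    (hl : ∀ n, l n ∈ resolventSet ℂ T ∧ l n ≠ 0) (hl0 : Tendsto l atTop (𝓝 0)) :
    GrowthSeq T l m := by
  obtain ⟨L, hL0, hL⟩ := h.exists_tendsto
  have hl0' : Tendsto l atTop (𝓝[≠] 0) :=
    tendsto_nhdsWithin_iff.mpr ⟨hl0, Eventually.of_forall fun n => (hl n).2⟩
  have hlim : Tendsto (fun n => l n ^ m • res T (l n)) atTop (𝓝 L) := hL.comp hl0'
  have key : ∀ (k n : ℕ) (C : ℝ), ‖res T (l n)‖ ≤ C * ‖l n‖ ^ (-(k : ℤ)) ↔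
      ‖l n ^ k • res T (l n)‖ ≤ C := fun k n C => by
    have hpos : 0 < ‖l n‖ ^ k := pow_pos (norm_pos_iff.mpr (hl n).2) k
    rw [norm_smul, norm_pow, zpow_neg, zpow_natCast, ← div_eq_mul_inv, le_div_iff₀ hpos, mul_comm]
  refine ⟨hl, hl0, ?_, fun k hk => ?_⟩
  · refine IsBigO.of_bound (‖L‖ + 1) ?_
    filter_upwards [hlim.norm.eventually_le_const (lt_add_one ‖L‖)] with n hn
    rw [norm_norm, norm_zpow, norm_norm]
    exact (key m n _).mpr hn
  · by_contra! hkm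
    obtain ⟨C, hC⟩ := hk.bound
    have h0 : Tendsto (fun n => l n ^ (m - k) • (l n ^ k • res T (l n))) atTop (𝓝 0) := by
      have h1 : Tendsto (fun n => l n ^ (m - k)) atTop (𝓝 0) := by
        simpa [zero_pow (Nat.sub_ne_zero_of_lt hkm)] using hl0.pow (m - k)
      refine h1.zero_smul_isBoundedUnder_le ⟨C, hC.mono fun n hn => ?_⟩
      rw [norm_norm, norm_zpow, norm_norm] at hn
      exact (key k n C).mp hn
    refine hL0 (tendsto_nhds_unique hlim (h0.congr fun n => ?_))
    rw [smul_smul, ← pow_add, Nat.sub_add_cancel hkm.le]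

variable [CompleteSpace X]

theorem differentiableAt_res {T : X →L[ℂ] X} {z : ℂ} (hz : z ∈ resolventSet ℂ T) :
    DifferentiableAt ℂ (res T) z := by
  have h1 : DifferentiableAt ℂ (Ring.inverse : (X →L[ℂ] X) → _) (T - z • (1 : X →L[ℂ] X)) :=
    differentiableAt_inverse (isUnit_sub_smul hz)
  have h2 : DifferentiableAt ℂ (fun w : ℂ => T - w • (1 : X →L[ℂ] X)) z := by fun_prop
  exact h1.comp z h2

theorem const_mul_circleIntegral {A : X →L[ℂ] X} {f : ℂ → X →L[ℂ] X} {r : ℝ}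
    (hf : CircleIntegrable f 0 r) :
    A * (∮ z in C(0, r), f z) = ∮ z in C(0, r), A * f z := by
  have h := (ContinuousLinearMap.mul ℂ (X →L[ℂ] X) A).intervalIntegral_comp_comm hf.out
  simp only [ContinuousLinearMap.mul_apply', mul_smul_comm] at h
  exact h.symm

theorem continuousOn_res_sphere {T : X →L[ℂ] X} {r : ℝ} (hr : 0 < r)
    (h : Metric.closedBall (0 : ℂ) r ∩ spectrum ℂ T = {0}) :
    ContinuousOn (res T) (Metric.sphere 0 r) := fun _ hz =>
  (differentiableAt_res (mem_resolventSet_of_inter_eq h (Metric.sphere_subset_closedBall hz)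
    (ne_zero_of_mem_sphere hr.ne' ⟨_, hz⟩))).continuousAt.continuousWithinAt

/-- Integrating `T * (z⁻¹ • res T z) = z⁻¹ • 1 + res T z` and applying `T ^ k` removes the resolvent
integral, leaving `T ^ (k + 1) * B = 2πi • T ^ k` for a bounded `B`. -/
theorem rangeStable_of_killsCircle {T : X →L[ℂ] X} {r : ℝ} {k : ℕ} (hr : 0 < r)
    (h : Metric.closedBall (0 : ℂ) r ∩ spectrum ℂ T = {0}) (hk : KillsCircle T r k) :
    RangeStable T k := by
  have hne : ∀ z ∈ Metric.sphere (0 : ℂ) r, z ≠ 0 := fun z hz =>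
    ne_zero_of_mem_sphere hr.ne' ⟨z, hz⟩
  have hcont := continuousOn_res_sphere hr h
  have hinv : ContinuousOn (fun z : ℂ => z⁻¹) (Metric.sphere 0 r) :=
    continuousOn_id.inv₀ hne
  have hint : CircleIntegrable (fun z => z⁻¹ • res T z) 0 r :=
    (hinv.smul hcont).circleIntegrable hr.le
  have hint' : CircleIntegrable (fun z => z⁻¹ • (1 : X →L[ℂ] X)) 0 r :=
    (hinv.smul continuousOn_const).circleIntegrable hr.le
  have h1 : T * (∮ z in C(0, r), z⁻¹ • res T z) =
      (2 * Real.pi * Complex.I : ℂ) • (1 : X →L[ℂ] X) + ∮ z in C(0, r), res T z := by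
    rw [const_mul_circleIntegral hint]
    rw [circleIntegral.integral_congr (g := fun z => z⁻¹ • (1 : X →L[ℂ] X) + res T z) hr.le]
    · rw [circleIntegral.integral_add hint' (hcont.circleIntegrable hr.le),
        circleIntegral.integral_smul_const]
      congr 2
      simpa using circleIntegral.integral_sub_center_inv (0 : ℂ) hr.ne'
    · intro z hz
      have hzr := mem_resolventSet_of_inter_eq h (Metric.sphere_subset_closedBall hz) (hne z hz)
      change T * (z⁻¹ • res T z) = _
      rw [mul_smul_comm, mul_res hzr, smul_add, inv_smul_smul₀ (hne z hz)]
  have h2 : T ^ (k + 1) * (∮ z in C(0, r), z⁻¹ • res T z) =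
      (2 * Real.pi * Complex.I : ℂ) • T ^ k := by
    rw [pow_succ, mul_assoc, h1, mul_add, mul_smul_comm, mul_one]
    rw [show T ^ k * (∮ z in C(0, r), res T z) = 0 from hk, add_zero]
  refine rangeStable_iff.mpr fun x => ?_
  refine ⟨(∮ z in C(0, r), z⁻¹ • res T z) ((2 * Real.pi * Complex.I : ℂ)⁻¹ • x), ?_⟩
  have h3 := congrArg (· ((2 * Real.pi * Complex.I : ℂ)⁻¹ • x)) h2
  change (T ^ (k + 1)) ((∮ z in C(0, r), z⁻¹ • res T z) ((2 * Real.pi * Complex.I : ℂ)⁻¹ • x)) =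
    (2 * Real.pi * Complex.I : ℂ) • (T ^ k) ((2 * Real.pi * Complex.I : ℂ)⁻¹ • x) at h3
  rw [h3, map_smul, smul_inv_smul₀ Complex.two_pi_I_ne_zero]

/-- By `pow_mul_res`, `T ^ m * res T z` is a polynomial plus `z ^ m • res T z`, so its singularity
at `0` is removable and Cauchy's theorem applies. -/
theorem killsCircle_of_tendsto {T L : X →L[ℂ] X} {r : ℝ} {m : ℕ} (hr : 0 < r)
    (h : Metric.closedBall (0 : ℂ) r ∩ spectrum ℂ T = {0})
    (hL : Tendsto (fun z => z ^ m • res T z) (𝓝[≠] 0) (𝓝 L)) : KillsCircle T r m := by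
  classical
  have hpoly : Tendsto (fun z : ℂ => ∑ i ∈ Finset.range m, z ^ (m - 1 - i) • T ^ i) (𝓝[≠] 0)
      (𝓝 (∑ i ∈ Finset.range m, (0 : ℂ) ^ (m - 1 - i) • T ^ i)) :=
    ((by fun_prop : Continuous fun z : ℂ =>
      ∑ i ∈ Finset.range m, z ^ (m - 1 - i) • T ^ i).tendsto 0).mono_left nhdsWithin_le_nhds
  have hball : ∀ᶠ z in 𝓝[≠] (0 : ℂ), z ∈ Metric.closedBall (0 : ℂ) r :=
    nhdsWithin_le_nhds (Metric.closedBall_mem_nhds _ hr)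
  have hlim := (hpoly.add hL).congr' (by
    filter_upwards [hball, self_mem_nhdsWithin] with z hz hz0
    exact (pow_mul_res (mem_resolventSet_of_inter_eq h hz hz0) m).symm)
  set B := (∑ i ∈ Finset.range m, (0 : ℂ) ^ (m - 1 - i) • T ^ i) + L
  have hd : ∀ z ∈ Metric.closedBall (0 : ℂ) r, z ≠ 0 →
      DifferentiableAt ℂ (Function.update (fun z => T ^ m * res T z) 0 B) z := fun z hz hz0 => by
    have h1 : DifferentiableAt ℂ (fun z => T ^ m * res T z) z :=
      (differentiableAt_res (mem_resolventSet_of_inter_eq h hz hz0)).const_mul _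
    refine h1.congr_of_eventuallyEq ?_
    filter_upwards [isOpen_ne.mem_nhds hz0] with w hw
    exact Function.update_of_ne hw _ _
  unfold KillsCircle
  rw [const_mul_circleIntegral ((continuousOn_res_sphere hr h).circleIntegrable hr.le)]
  rw [circleIntegral.integral_congr (g := Function.update (fun z => T ^ m * res T z) 0 B) hr.le
    fun z hz => (Function.update_of_ne (ne_zero_of_mem_sphere hr.ne' ⟨z, hz⟩) _ _).symm]
  refine Complex.circleIntegral_eq_zero_of_differentiable_on_off_countable hr.le
    (Set.countable_singleton 0) (fun z hz => ?_) fun z hz =>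
      hd z (Metric.ball_subset_closedBall hz.1) hz.2
  rcases eq_or_ne z 0 with rfl | hz0
  · exact (continuousAt_update_same.mpr hlim).continuousWithinAt
  · exact (hd z hz hz0).continuousAt.continuousWithinAt

theorem not_zeroIsPole_of_mem_resolventSet {T : X →L[ℂ] X} (h0 : 0 ∈ resolventSet ℂ T) {m : ℕ}
    (hm : 1 ≤ m) : ¬ ZeroIsPole T m := fun h => by
  obtain ⟨L, hL0, hL⟩ := h.exists_tendsto
  refine hL0 (tendsto_nhds_unique hL ?_)
  have h1 : ContinuousAt (fun z : ℂ => z ^ m • res T z) 0 :=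
    (continuousAt_id.pow m).smul (differentiableAt_res h0).continuousAt
  simpa [zero_pow (by omega : m ≠ 0)] using h1.tendsto.mono_left nhdsWithin_le_nhds

theorem zero_mem_spectrum_of_growthSeq {T : X →L[ℂ] X} {l : ℕ → ℂ} {m : ℕ} (hm : 1 ≤ m)
    (h : GrowthSeq T l m) : 0 ∈ spectrum ℂ T := by
  by_contra h0
  obtain ⟨-, hl0, -, hmin⟩ := h
  have h1 : Tendsto (fun n => ‖res T (l n)‖) atTop (𝓝 ‖res T 0‖) :=
    ((differentiableAt_res (not_not.mp h0)).continuousAt.tendsto.comp hl0).norm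
  have h2 : 0 ∈ {k : ℕ | (fun n => ‖res T (l n)‖) =O[atTop] (fun n => ‖l n‖ ^ (-(k : ℤ)))} := by
    simpa using h1.isBigO_one ℝ
  have := hmin h2
  omega

end PoleResolvent

/-! ### Spectral projection, Drazin inverse and Laurent expansion -/

namespace PoleResolvent

variable {X : Type*} [NormedAddCommGroup X] [NormedSpace ℂ X]

/-- The Laurent expansion of the resolvent in terms of the Drazin inverse. -/
theorem isUnit_and_res_eq {T S Q : X →L[ℂ] X} {p : ℕ} (hTS : T * S = 1 - Q) (hST : S * T = 1 - Q)
    (hQS : Q * S = 0) (hTQ : T * Q = Q * T) (hpQ : T ^ p * Q = 0) {z : ℂ}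
    (hz : z ≠ 0) (hu : IsUnit (1 - z • S)) : z ∈ resolventSet ℂ T ∧
      res T z = S * Ring.inverse (1 - z • S) -
        ∑ j ∈ Finset.range p, (z ^ (j + 1))⁻¹ • (T ^ j * Q) := by
  obtain ⟨U, hU⟩ := hu
  rw [← hU, Ring.inverse_unit]
  set G : X →L[ℂ] X := S * ↑U⁻¹ - ∑ j ∈ Finset.range p, (z ^ (j + 1))⁻¹ • (T ^ j * Q) with hG
  have hcTS : Commute T S := hTS.trans hST.symm
  have hcTU : Commute T (↑U⁻¹ : X →L[ℂ] X) := by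
    refine Commute.units_inv_right ?_
    rw [hU]
    exact (Commute.one_right T).sub_right (hcTS.smul_right z)
  have hcG : Commute (T - z • (1 : X →L[ℂ] X)) G := by
    refine Commute.sub_left ?_ ((Commute.one_left G).smul_left z)
    refine (hcTS.mul_right hcTU).sub_right (Commute.sum_right _ _ _ fun j _ => ?_)
    exact (((Commute.refl T).pow_right j).mul_right hTQ).smul_right _
  have hQU : Q * ↑U⁻¹ = Q := by
    rw [Units.mul_inv_eq_iff_eq_mul, hU, mul_sub, mul_one, mul_smul_comm, hQS, smul_zero, sub_zero]
  have h1 : (T - z • (1 : X →L[ℂ] X)) * (S * ↑U⁻¹) = 1 - Q := by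
    rw [← mul_assoc, sub_mul, hTS, smul_mul_assoc, one_mul, sub_right_comm, ← hU, sub_mul,
      Units.mul_inv, hQU]
  -- The sum telescopes to `z⁻ᵖ • (T ^ p * Q) - Q`, and the first term vanishes.
  have h2 : (T - z • (1 : X →L[ℂ] X)) *
      ∑ j ∈ Finset.range p, (z ^ (j + 1))⁻¹ • (T ^ j * Q) = -Q := by
    have h3 : ∀ j, (T - z • (1 : X →L[ℂ] X)) * ((z ^ (j + 1))⁻¹ • (T ^ j * Q)) =
        (z ^ (j + 1))⁻¹ • (T ^ (j + 1) * Q) - (z ^ j)⁻¹ • (T ^ j * Q) := fun j => by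
      rw [sub_mul, mul_smul_comm, ← mul_assoc, ← pow_succ', smul_mul_assoc, one_mul, smul_smul]
      congr 2
      field_simp
      ring
    rw [Finset.mul_sum, Finset.sum_congr rfl fun j _ => h3 j,
      Finset.sum_range_sub fun j => (z ^ j)⁻¹ • (T ^ j * Q), hpQ]
    simp
  have h4 : (T - z • (1 : X →L[ℂ] X)) * G = 1 := by rw [hG, mul_sub, h1, h2]; abel
  have hz' : z ∈ resolventSet ℂ T := by
    rw [spectrum.mem_resolventSet_iff, Algebra.algebraMap_eq_smul_one, ← IsUnit.neg_iff, neg_sub]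
    exact ⟨⟨_, G, h4, hcG.eq ▸ h4⟩, rfl⟩
  refine ⟨hz', ?_⟩
  rw [← mul_one (res T z), ← h4, ← mul_assoc, (res_mul_cancel T hz').1, one_mul]

variable [CompleteSpace X]

/-- If `X` is the direct sum of the kernel and the range of an operator, then the projection onto
the kernel along the range is continuous. -/
theorem exists_projection_ker {A : X →L[ℂ] X} (h : IsCompl A.ker A.range) :
    ∃ Q : X →L[ℂ] X, (∀ x, A (Q x) = 0) ∧ (∀ x, A x = 0 → Q x = x) ∧
      ∀ x, Q x = 0 ↔ ∃ y, A y = x := by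
  set N := A.ker
  have : CompleteSpace N := A.isClosed_ker.completeSpace_coe
  let Q₀ : X →ₗ[ℂ] X := N.projection A.range h
  let F : (X × N) →L[ℂ] X :=
    A.comp (ContinuousLinearMap.fst ℂ X N) + N.subtypeL.comp (ContinuousLinearMap.snd ℂ X N)
  have hQF : ∀ (y : X) (n : N), Q₀ (A y + n) = n := fun y n => by
    have h1 : Q₀ (A y) = 0 := (Submodule.projection_apply_eq_zero_iff h).mpr ⟨y, rfl⟩
    have h2 : Q₀ (n : X) = n := Submodule.projection_apply_left h n
    rw [map_add, h1, h2, zero_add]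
  have hF : Function.Surjective F := fun x => by
    obtain ⟨y, hy⟩ : x - Q₀ x ∈ A.range := Submodule.sub_projection_mem h x
    refine ⟨(y, ⟨Q₀ x, Submodule.projection_apply_mem h x⟩), ?_⟩
    change A y + Q₀ x = x
    rw [show A y = x - Q₀ x from hy, sub_add_cancel]
  -- The open mapping theorem bounds the component `n` of `A y + n`, which is the value of the
  -- projection.
  obtain ⟨C, -, hC⟩ := F.exists_preimage_norm_le hF
  let Q : X →L[ℂ] X := Q₀.mkContinuous C fun x => by
    obtain ⟨⟨y, n⟩, rfl, hn⟩ := hC x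
    change ‖Q₀ (A y + n)‖ ≤ _
    rw [hQF]
    exact (norm_snd_le (y, n)).trans hn
  refine ⟨Q, fun x => Submodule.projection_apply_mem h x, fun x hx => ?_, fun x => ?_⟩
  · exact (Submodule.projection_eq_self_iff h x).mpr hx
  · exact Submodule.projection_apply_eq_zero_iff h

/-- The spectral projection `Q` at `0` and the Drazin inverse `S` of an operator whose ascent and
descent are at most `p`. -/
theorem exists_drazin_inverse {T : X →L[ℂ] X} {p : ℕ} (ha : KerStable T p)
    (hd : RangeStable T p) : ∃ S Q : X →L[ℂ] X, T * S = 1 - Q ∧ S * T = 1 - Q ∧ Q * S = 0 ∧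
      T * Q = Q * T ∧ T ^ p * Q = 0 ∧ ∀ x, (T ^ p) x = 0 → Q x = x := by
  obtain ⟨Q, hQ1, hQ2, hQ3⟩ := exists_projection_ker (decomposes_of_stable ha hd)
  have hcomm : ∀ v, (T ^ p) (T v) = T ((T ^ p) v) := fun v => by
    change (T ^ p * T) v = (T * T ^ p) v
    rw [← pow_succ, pow_succ']
  have hQQ : Q * Q = Q := ContinuousLinearMap.ext fun x => hQ2 _ (hQ1 x)
  have hrange : ∀ x, ∃ u, (T ^ p) u = x - Q x := fun x => by
    refine (hQ3 _).mp ?_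
    rw [map_sub, hQ2 _ (hQ1 x), sub_self]
  have hTQ : T * Q = Q * T := ContinuousLinearMap.ext fun x => by
    obtain ⟨u, hu⟩ := hrange x
    change T (Q x) = Q (T x)
    have h1 : Q (T x) = Q (T (Q x) + (T ^ p) (T u)) := by
      rw [hcomm, hu, map_sub, add_sub_cancel]
    rw [h1, map_add, (hQ3 ((T ^ p) (T u))).mpr ⟨_, rfl⟩, add_zero,
      hQ2 (T (Q x)) (by rw [hcomm, hQ1, map_zero])]
  -- `V` is `T` on `ran T ^ p` and the identity on `ker T ^ p`. It is bijective, and the Drazin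
  -- inverse is `V⁻¹ * (1 - Q)`.
  set V : X →L[ℂ] X := T * (1 - Q) + Q with hV
  have hQV : Q * V = Q := by
    rw [hV, mul_add, ← mul_assoc, ← hTQ, mul_assoc, mul_sub, mul_one, hQQ, sub_self, mul_zero,
      zero_add]
  have hVQ : V * Q = Q := by
    rw [hV, add_mul, mul_assoc, sub_mul, one_mul, hQQ, sub_self, mul_zero, zero_add]
  have hTV : T * V = V * T := by
    rw [hV, mul_add, add_mul, mul_assoc T (1 - Q) T, sub_mul, one_mul, ← hTQ, mul_sub T 1 Q,
      mul_one]
  have hTV' : T * (1 - Q) = V - Q := by rw [hV, add_sub_cancel_right]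
  have hbij : Function.Bijective V := by
    constructor
    · refine (injective_iff_map_eq_zero V).mpr fun x hx => ?_
      have hQx : Q x = 0 := by
        rw [← hQV]
        change Q (V x) = 0
        rw [hx, map_zero]
      have hTx : T x = 0 := by
        have : V x = T (x - Q x) + Q x := rfl
        rwa [hQx, sub_zero, add_zero, hx, eq_comm] at this
      rw [← hQ2 x (kerStable_iff.mp ha x (by rw [pow_add_apply, pow_one, hTx, map_zero])), hQx]
    · intro y
      obtain ⟨u, hu⟩ := hrange y
      obtain ⟨v, hv⟩ := rangeStable_iff.mp hd u
      refine ⟨Q y + (T ^ p) v, ?_⟩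
      have h1 : V (Q y) = Q y := congrArg (· y) hVQ
      have h2 : V ((T ^ p) v) = y - Q y := by
        change T ((T ^ p) v - Q ((T ^ p) v)) + Q ((T ^ p) v) = _
        rw [(hQ3 _).mpr ⟨_, rfl⟩, sub_zero, add_zero, ← hu, ← hv, ← hcomm, pow_add_apply, pow_one]
      rw [map_add, h1, h2, add_sub_cancel]
  obtain ⟨U, hU⟩ := ContinuousLinearMap.isUnit_iff_bijective.mpr hbij
  rw [← hU] at hQV hVQ hTV hTV'
  have hUQ : ↑U⁻¹ * Q = Q := by rw [Units.inv_mul_eq_iff_eq_mul, hVQ]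
  have hQU : Q * ↑U⁻¹ = Q := by rw [Units.mul_inv_eq_iff_eq_mul, hQV]
  have hTU : T * ↑U⁻¹ = ↑U⁻¹ * T := (show Commute T ↑U from hTV).units_inv_right
  have h1 : (↑U⁻¹ : X →L[ℂ] X) * (T * (1 - Q)) = 1 - Q := by
    rw [hTV', mul_sub, Units.inv_mul, hUQ]
  refine ⟨↑U⁻¹ * (1 - Q), Q, ?_, ?_, ?_, hTQ, ContinuousLinearMap.ext hQ1, hQ2⟩
  · rw [← mul_assoc, hTU, mul_assoc, h1]
  · rw [mul_assoc, sub_mul, one_mul, ← hTQ, ← h1, mul_sub T 1 Q, mul_one]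
  · rw [← mul_assoc, hQU, mul_sub, mul_one, hQQ, sub_self]

theorem zeroIsPole_of_isLeast {T : X →L[ℂ] X} {p : ℕ} (hp : 1 ≤ p)
    (ha : IsLeast {n | KerStable T n} p) (hd : RangeStable T p) : ZeroIsPole T p := by
  obtain ⟨S, Q, hTS, hST, hQS, hTQ, hpQ, hQ⟩ := exists_drazin_inverse ha.1 hd
  obtain ⟨q, rfl⟩ := Nat.exists_eq_add_of_le' hp
  -- Minimality of the ascent `q + 1` makes the leading coefficient nonzero, so the pole order is
  -- exact.
  have hq : T ^ q * Q ≠ 0 := fun h0 => by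
    have : KerStable T q := kerStable_iff.mpr fun x hx => by
      rw [← hQ x hx]
      exact congrArg (· x) h0
    have := ha.2 this
    omega
  have hcont : Continuous fun z : ℂ => 1 - z • S := by fun_prop
  have hunit : ∀ᶠ z in 𝓝[≠] (0 : ℂ), IsUnit (1 - z • S) := by
    refine nhdsWithin_le_nhds (hcont.continuousAt.eventually_mem (Units.isOpen.mem_nhds ?_))
    simp
  have hres : ∀ᶠ z in 𝓝[≠] (0 : ℂ), z ∈ resolventSet ℂ T ∧
      res T z = S * Ring.inverse (1 - z • S) -
        ∑ j ∈ Finset.range (q + 1), (z ^ (j + 1))⁻¹ • (T ^ j * Q) := by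
    filter_upwards [hunit, self_mem_nhdsWithin] with z hz hz0
    exact isUnit_and_res_eq hTS hST hQS hTQ hpQ hz0 hz
  let g : ℂ → X →L[ℂ] X := fun z => z ^ (q + 1) • (S * Ring.inverse (1 - z • S)) -
    ∑ j ∈ Finset.range (q + 1), z ^ (q - j) • (T ^ j * Q)
  have hW : AnalyticAt ℂ (fun z : ℂ => Ring.inverse (1 - z • S)) 0 := by
    have h1 : AnalyticAt ℂ (fun z : ℂ => z • S) 0 := analyticAt_id.smul analyticAt_const
    have h2 := analyticAt_inverse_one_sub ℂ (X →L[ℂ] X)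
    exact AnalyticAt.comp_of_eq h2 h1 (zero_smul ℂ S)
  have hg : AnalyticAt ℂ g 0 := by
    refine ((analyticAt_id.pow (q + 1)).smul (analyticAt_const.mul hW)).sub ?_
    exact Finset.analyticAt_fun_sum _ fun j _ => (analyticAt_id.pow _).smul analyticAt_const
  have hg0 : g 0 ≠ 0 := by
    have h1 : ∑ j ∈ Finset.range (q + 1), (0 : ℂ) ^ (q - j) • (T ^ j * Q) = T ^ q * Q := by
      rw [Finset.sum_eq_single_of_mem q (Finset.self_mem_range_succ q)]
      · simp
      · intro j hj hjq
        have := Finset.mem_range.mp hj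
        rw [zero_pow (by omega), zero_smul]
    change (0 : ℂ) ^ (q + 1) • _ - _ ≠ _
    rw [h1, zero_pow (Nat.succ_ne_zero q), zero_smul, zero_sub, neg_ne_zero]
    exact hq
  have hfg : ∀ᶠ z in 𝓝[≠] (0 : ℂ), res T z = (z - 0) ^ (-((q + 1 : ℕ) : ℤ)) • g z := by
    filter_upwards [hres, self_mem_nhdsWithin] with z hz hz0
    have hz0 : z ≠ 0 := hz0
    rw [hz.2, sub_zero, zpow_neg, zpow_natCast, smul_sub, inv_smul_smul₀ (pow_ne_zero _ hz0),
      Finset.smul_sum]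
    congr 1
    refine Finset.sum_congr rfl fun j hj => ?_
    have hj := Finset.mem_range.mp hj
    rw [smul_smul]
    congr 1
    have h2 : z ^ (q + 1) = z ^ (q - j) * z ^ (j + 1) := by
      rw [← pow_add]
      congr 1
      omega
    rw [h2]
    field_simp
  have hmero : MeromorphicAt (res T) 0 := by
    refine MeromorphicAt.congr (f := fun z => (z - 0) ^ (-((q + 1 : ℕ) : ℤ)) • g z) ?_
      (hfg.mono fun z hz => hz.symm)
    exact ((MeromorphicAt.id 0).sub (MeromorphicAt.const 0 0)).zpow _ |>.smul hg.meromorphicAt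
  exact ⟨hres.mono fun z hz => hz.1, hmero,
    (meromorphicOrderAt_eq_int_iff hmero).mpr ⟨g, hg, hg0, hfg⟩⟩

theorem isClosed_range_of_stable {T : X →L[ℂ] X} {p : ℕ} (ha : KerStable T p)
    (hd : RangeStable T p) : IsClosed ((T ^ p).range : Set X) := by
  obtain ⟨Q, -, -, hQ⟩ := exists_projection_ker (decomposes_of_stable ha hd)
  convert Q.isClosed_ker
  ext x
  exact (hQ x).symm

end PoleResolvent

/-! ### From finite descent to a pole of the right order -/

namespace PoleResolvent

variable {X : Type*} [NormedAddCommGroup X] [NormedSpace ℂ X]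

theorem ZeroIsolated.exists_radius {T : X →L[ℂ] X} (h : ZeroIsolated T) :
    ∃ r : ℝ, 0 < r ∧ Metric.closedBall (0 : ℂ) r ∩ spectrum ℂ T = {0} := by
  obtain ⟨h0, hev⟩ := h
  obtain ⟨r, hr, hball⟩ := Metric.nhds_basis_closedBall.mem_iff.mp
    (eventually_nhdsWithin_iff.mp hev)
  refine ⟨r, hr, Set.Subset.antisymm (fun z hz => ?_) ?_⟩
  · by_contra hz0
    exact hball hz.1 hz0 hz.2
  · rintro _ rfl
    exact ⟨Metric.mem_closedBall_self hr.le, h0⟩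

theorem frequently_mem_resolventSet_of_eventually {T : X →L[ℂ] X}
    (h : ∀ᶠ z in 𝓝[≠] (0 : ℂ), z ∈ resolventSet ℂ T) :
    ∃ᶠ z in 𝓝 (0 : ℂ), z ∈ resolventSet ℂ T :=
  h.frequently.filter_mono nhdsWithin_le_nhds

theorem exists_seq_tendsto_zero {T : X →L[ℂ] X}
    (h : ∀ᶠ z in 𝓝[≠] (0 : ℂ), z ∈ resolventSet ℂ T) :
    ∃ l : ℕ → ℂ, (∀ n, l n ∈ resolventSet ℂ T ∧ l n ≠ 0) ∧ Tendsto l atTop (𝓝 0) := by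
  obtain ⟨l, hl0, hl⟩ := exists_seq_forall_of_frequently
    (h.and self_mem_nhdsWithin).frequently
  exact ⟨l, hl, tendsto_nhds_of_tendsto_nhdsWithin hl0⟩

theorem ZeroIsolated.frequently {T : X →L[ℂ] X} (h : ZeroIsolated T) :
    ∃ᶠ z in 𝓝 (0 : ℂ), z ∈ resolventSet ℂ T :=
  frequently_mem_resolventSet_of_eventually (h.2.mono fun _ hz => not_not.mp hz)

theorem isLeast_decomposes {T : X →L[ℂ] X} {p : ℕ} (hp : 1 ≤ p)
    (ha : IsLeast {n | KerStable T n} p) (hd : RangeStable T p) :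
    IsLeast {k : ℕ | 1 ≤ k ∧ Decomposes T k} p :=
  ⟨⟨hp, decomposes_of_stable ha.1 hd⟩, fun _ hk => ha.2 (kerStable_of_decomposes hk.1 hk.2)⟩

variable [CompleteSpace X]

theorem isLeast_killsCircle {T : X →L[ℂ] X} {p : ℕ} {r : ℝ} (hr : 0 < r)
    (h : Metric.closedBall (0 : ℂ) r ∩ spectrum ℂ T = {0})
    (hd : IsLeast {n | RangeStable T n} p) (hpole : ZeroIsPole T p) :
    IsLeast {k : ℕ | KillsCircle T r k} p := by
  obtain ⟨L, -, hL⟩ := hpole.exists_tendsto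
  exact ⟨killsCircle_of_tendsto hr h hL, fun k hk => hd.2 (rangeStable_of_killsCircle hr h hk)⟩

theorem one_le_of_stable {T : X →L[ℂ] X} {p : ℕ} (h0 : 0 ∈ spectrum ℂ T) (ha : KerStable T p)
    (hd : RangeStable T p) : 1 ≤ p := by
  by_contra! hp
  obtain rfl : p = 0 := by omega
  refine h0 (zero_mem_resolventSet_iff.mpr (ContinuousLinearMap.isUnit_iff_bijective.mpr ⟨?_, ?_⟩))
  · refine (injective_iff_map_eq_zero T).mpr fun x hx => ?_
    simpa using kerStable_iff.mp ha x (by simpa using hx)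
  · intro x
    obtain ⟨y, hy⟩ := rangeStable_iff.mp hd x
    exact ⟨y, by simpa using hy⟩

/-- If `0` is a spectral value that is a limit of points of the resolvent set and the descent is
finite, then ascent and descent coincide, and `0` is a pole of that order. -/
theorem exists_pole_of_rangeStable {T : X →L[ℂ] X} {d : ℕ} (h0 : 0 ∈ spectrum ℂ T)
    (hT : ∃ᶠ z in 𝓝 (0 : ℂ), z ∈ resolventSet ℂ T) (hd : RangeStable T d) :
    ∃ p : ℕ, 1 ≤ p ∧ IsLeast {n | KerStable T n} p ∧ IsLeast {n | RangeStable T n} p ∧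
      ZeroIsPole T p := by
  obtain ⟨p, hpa, hpd⟩ := exists_ascent_eq_descent (hd.kerStable_of_frequently hT) hd
  have hp : 1 ≤ p := one_le_of_stable h0 hpa.1 hpd.1
  exact ⟨p, hp, hpa, hpd, zeroIsPole_of_isLeast hp hpa hpd.1⟩

theorem ZeroIsPole.zero_mem_spectrum {T : X →L[ℂ] X} {m : ℕ} (hm : 1 ≤ m)
    (h : ZeroIsPole T m) : 0 ∈ spectrum ℂ T := fun h0 =>
  not_zeroIsPole_of_mem_resolventSet h0 hm h

theorem ZeroIsPole.zeroIsolated {T : X →L[ℂ] X} {m : ℕ} (hm : 1 ≤ m) (h : ZeroIsPole T m) :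
    ZeroIsolated T :=
  ⟨h.zero_mem_spectrum hm, h.1.mono fun _ hz hz' => hz' hz⟩

/-- A pole gives finite descent through the contour integral, hence a pole of order `p`, the common
value of ascent and descent. Uniqueness of the meromorphic order gives `p = m`. -/
theorem ZeroIsPole.isLeast_stable {T : X →L[ℂ] X} {m : ℕ} (hm : 1 ≤ m) (h : ZeroIsPole T m) :
    IsLeast {n | KerStable T n} m ∧ IsLeast {n | RangeStable T n} m := by
  obtain ⟨r, hr, hσ⟩ := (h.zeroIsolated hm).exists_radius
  obtain ⟨L, -, hL⟩ := h.exists_tendsto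
  obtain ⟨p, -, hpa, hpd, hpole⟩ := exists_pole_of_rangeStable (h.zero_mem_spectrum hm)
    (frequently_mem_resolventSet_of_eventually h.1)
    (rangeStable_of_killsCircle hr hσ (killsCircle_of_tendsto hr hσ hL))
  have hpm : ((-(m : ℤ) : ℤ) : WithTop ℤ) = ((-(p : ℤ) : ℤ) : WithTop ℤ) := h.2.2.symm.trans hpole.2.2
  obtain rfl : m = p := by
    have := WithTop.coe_injective hpm
    omega
  exact ⟨hpa, hpd⟩

theorem zeroIsPole_of_growthSeq {T : X →L[ℂ] X} {l : ℕ → ℂ} {m d : ℕ} (hm : 1 ≤ m)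
    (h : GrowthSeq T l m) (hd : RangeStable T d) : ZeroIsPole T m := by
  have hfreq : ∃ᶠ z in 𝓝 (0 : ℂ), z ∈ resolventSet ℂ T :=
    h.2.1.frequently (Eventually.of_forall fun n => (h.1 n).1).frequently
  obtain ⟨p, -, -, -, hpole⟩ :=
    exists_pole_of_rangeStable (zero_mem_spectrum_of_growthSeq hm h) hfreq hd
  rwa [h.2.2.unique (hpole.growthSeq h.1 h.2.1).2.2]

end PoleResolvent

/-! ### The equivalences -/

theorem mainTheorem2 {X : Type*} [NormedAddCommGroup X] [NormedSpace ℂ X] [CompleteSpace X]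
    (hX : TopologicalSpace.SeparableSpace X ∨ PoleResolvent.Reflexive X)
    (T : X →L[ℂ] X) (m : ℕ) (hm : 1 ≤ m) :
    List.TFAE [
      -- (i)
      PoleResolvent.ZeroIsPole T m,
      -- (ii), with one admissible circle
      PoleResolvent.ZeroIsolated T ∧
        ∃ r : ℝ, 0 < r ∧ Metric.closedBall (0 : ℂ) r ∩ spectrum ℂ T = {0} ∧
          IsLeast {k : ℕ | PoleResolvent.KillsCircle T r k} m,
      -- (ii), with every admissible circle
      PoleResolvent.ZeroIsolated T ∧
        ∀ r : ℝ, 0 < r → Metric.closedBall (0 : ℂ) r ∩ spectrum ℂ T = {0} →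
          IsLeast {k : ℕ | PoleResolvent.KillsCircle T r k} m,
      -- (iii)
      PoleResolvent.ZeroIsolated T ∧ PoleResolvent.descent T = m,
      -- (iv)
      0 ∈ spectrum ℂ T ∧ IsLeast {k : ℕ | 1 ≤ k ∧ PoleResolvent.Decomposes T k} m,
      -- (v)
      PoleResolvent.ascent T = m ∧ PoleResolvent.descent T = m,
      -- (vi)
      (∃ l : ℕ → ℂ, PoleResolvent.GrowthSeq T l m) ∧ IsClosed ((T ^ m).range : Set X),
      -- (vii)
      (∃ l : ℕ → ℂ, PoleResolvent.GrowthSeq T l m) ∧ PoleResolvent.descent T < ⊤] := by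
  tfae_have 1 → 3 := fun h =>
    ⟨h.zeroIsolated hm, fun r hr hσ =>
      PoleResolvent.isLeast_killsCircle hr hσ (h.isLeast_stable hm).2 h⟩
  tfae_have 3 → 2 := fun ⟨h, hall⟩ => by
    obtain ⟨r, hr, hσ⟩ := h.exists_radius
    exact ⟨h, r, hr, hσ, hall r hr hσ⟩
  tfae_have 2 → 1 := fun ⟨h, r, hr, hσ, hleast⟩ => by
    obtain ⟨p, -, -, hpd, hpole⟩ := PoleResolvent.exists_pole_of_rangeStable h.1 h.frequently
      (PoleResolvent.rangeStable_of_killsCircle hr hσ hleast.1)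
    rwa [hleast.unique (PoleResolvent.isLeast_killsCircle hr hσ hpd hpole)]
  tfae_have 1 → 4 := fun h =>
    ⟨h.zeroIsolated hm, PoleResolvent.descent_eq_iff.mpr (h.isLeast_stable hm).2⟩
  tfae_have 4 → 1 := fun ⟨h, hd⟩ => by
    have hd := PoleResolvent.descent_eq_iff.mp hd
    obtain ⟨p, -, -, hpd, hpole⟩ :=
      PoleResolvent.exists_pole_of_rangeStable h.1 h.frequently hd.1
    rwa [hd.unique hpd]
  tfae_have 1 → 5 := fun h =>
    ⟨h.zero_mem_spectrum hm,
      PoleResolvent.isLeast_decomposes hm (h.isLeast_stable hm).1 (h.isLeast_stable hm).2.1⟩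
  tfae_have 5 → 6 := fun ⟨h0, hdec⟩ => by
    have ha := PoleResolvent.kerStable_of_decomposes hm hdec.1.2
    have hd := PoleResolvent.rangeStable_of_decomposes hm hdec.1.2
    obtain ⟨p, hpa, hpd⟩ := PoleResolvent.exists_ascent_eq_descent ha hd
    have hp : 1 ≤ p := PoleResolvent.one_le_of_stable h0 hpa.1 hpd.1
    obtain rfl := hdec.unique (PoleResolvent.isLeast_decomposes hp hpa hpd.1)
    exact ⟨PoleResolvent.ascent_eq_iff.mpr hpa, PoleResolvent.descent_eq_iff.mpr hpd⟩
  tfae_have 6 → 1 := fun ⟨ha, hd⟩ =>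
    PoleResolvent.zeroIsPole_of_isLeast hm (PoleResolvent.ascent_eq_iff.mp ha)
      (PoleResolvent.descent_eq_iff.mp hd).1
  tfae_have 1 → 7 := fun h => by
    obtain ⟨l, hl, hl0⟩ := PoleResolvent.exists_seq_tendsto_zero h.1
    exact ⟨⟨l, h.growthSeq hl hl0⟩, PoleResolvent.isClosed_range_of_stable
      (h.isLeast_stable hm).1.1 (h.isLeast_stable hm).2.1⟩
  tfae_have 7 → 8 := fun ⟨⟨l, hl⟩, hcl⟩ =>
    ⟨⟨l, hl⟩, PoleResolvent.iInf_natCast_lt_top_iff.mpr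
      ⟨m, PoleResolvent.rangeStable_of_isBigO hl.1 hl.2.1 hl.2.2.1 hcl⟩⟩
  tfae_have 8 → 1 := fun ⟨⟨l, hl⟩, hd⟩ => by
    obtain ⟨d, hd⟩ := PoleResolvent.iInf_natCast_lt_top_iff.mp hd
    exact PoleResolvent.zeroIsPole_of_growthSeq hm hl hd
  tfae_finish
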